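/- Let $G$ be a totally disconnected locally compact (Hausdorff) topological group, let $\varphi: G\to G$ be a topological automorphism (a group automorphism that is a homeomorphism), and let $H$ be a closed normal subgroup of $G$ that is $\varphi$-stable, i.e. $\varphi(H)=H$. Then $$h_{top}(\varphi)=h_{top}(\varphi\restriction_H)+h_{top}(\bar\varphi)\quad\text{in }[0,\infty],$$ where $\varphi\restriction_H:H\to H$ is the restriction of $\varphi$ and $\bar\varphi:G/H\to G/H$, $xH\mapsto\varphi(x)H$, is the topological automorphism induced by $\varphi$. Here $h_{top}$ denotes the topological entropy in the sense of Bowen and Hood, computed in each of $G$, $H$, $G/H$ with respect to the left uniformity of the group (the one with fundamental entourages $\{(x,y): y^{-1}x\in V\}$, $V$ a neighbourhood of $1$): for a uniformly continuous self-map $f:X\to X$ of a uniform space $X$, $$h_{top}(f)=\sup_{K}\ \sup_{U}\ \limsup_{n\to\infty}\frac{\log r_n(U,K,f)}{n},$$ where $K$ ranges over the compact subsets of $X$, $U$ over the entourages of $X$, and $r_n(U,K,f)$ is the least cardinality of a finite set $S\subseteq X$ such that for every $x\in K$ there is $y\in S$ with $(f^k(x),f^k(y))\in U$ for all $0\le k<n$.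 -/

import Mathlib

/-- The topological entropy (in the sense of Bowen and Hood) of a self-map `f` of a uniform space
`X`: the supremum over the compact sets `K ⊆ X` and the entourages `U` of the exponential growth
rate (a `limsup`) of the minimal number of points which `(n, U)`-span `K` under `f`. -/
noncomputable def topEntropy {X : Type*} [UniformSpace X] (f : X → X) : EReal :=
  ⨆ (K : Set X) (_ : IsCompact K), Dynamics.coverEntropy f K

/-- The topological entropy of a self-map of a topological group, computed with respect to the
left uniformity of the group. -/
noncomputable def groupTopEntropy {G : Type*} [Group G] [TopologicalSpace G]
    [IsTopologicalGroup G] (f : G → G) : EReal :=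
  @topEntropy G (IsTopologicalGroup.leftUniformSpace G) f

/-- A subgroup `H` is `φ`-stable if `φ H = H`. -/
def IsStable {G : Type*} [Group G] [TopologicalSpace G] (φ : G ≃ₜ* G) (H : Subgroup G) : Prop :=
  H.map (φ.toMulEquiv : G →* G) = H

theorem IsStable.apply_mem {G : Type*} [Group G] [TopologicalSpace G] {φ : G ≃ₜ* G}
    {H : Subgroup G} (hH : IsStable φ H) {x : G} (hx : x ∈ H) : φ x ∈ H := by
  have h : φ x ∈ H.map (φ.toMulEquiv : G →* G) := ⟨x, hx, rfl⟩
  rwa [show H.map (φ.toMulEquiv : G →* G) = H from hH] at h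

theorem IsStable.symm_apply_mem {G : Type*} [Group G] [TopologicalSpace G] {φ : G ≃ₜ* G}
    {H : Subgroup G} (hH : IsStable φ H) {x : G} (hx : x ∈ H) : φ.symm x ∈ H := by
  have h : x ∈ H.map (φ.toMulEquiv : G →* G) := by
    rwa [show H.map (φ.toMulEquiv : G →* G) = H from hH]
  obtain ⟨y, hy, rfl⟩ := h
  have e : φ.symm (φ y) = y := φ.symm_apply_apply y
  exact e.symm ▸ hy

/-- The topological automorphism of a `φ`-stable subgroup `H` given by restriction of `φ`. -/
def restrictAut {G : Type*} [Group G] [TopologicalSpace G] (φ : G ≃ₜ* G) (H : Subgroup G)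
    (hH : IsStable φ H) : H ≃ₜ* H where
  toFun x := ⟨φ x, hH.apply_mem x.2⟩
  invFun x := ⟨φ.symm x, hH.symm_apply_mem x.2⟩
  left_inv x := Subtype.ext (φ.symm_apply_apply x)
  right_inv x := Subtype.ext (φ.apply_symm_apply x)
  map_mul' x y := Subtype.ext (map_mul φ (x : G) (y : G))
  continuous_toFun := (φ.continuous_toFun.comp continuous_subtype_val).subtype_mk _
  continuous_invFun := (φ.continuous_invFun.comp continuous_subtype_val).subtype_mk _

/-- The topological automorphism `x H ↦ φ x H` of `G ⧸ H` induced by `φ`, for a `φ`-stable normal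
subgroup `H`. -/
def quotientAut {G : Type*} [Group G] [TopologicalSpace G] (φ : G ≃ₜ* G) (H : Subgroup G)
    [H.Normal] (hH : IsStable φ H) : G ⧸ H ≃ₜ* G ⧸ H where
  toMulEquiv := QuotientGroup.congr H H φ.toMulEquiv hH
  continuous_toFun :=
    continuous_quot_lift _ (QuotientGroup.continuous_mk.comp φ.continuous_toFun)
  continuous_invFun :=
    continuous_quot_lift _ (QuotientGroup.continuous_mk.comp φ.continuous_invFun)

theorem quotientAut_mk {G : Type*} [Group G] [TopologicalSpace G] (φ : G ≃ₜ* G) (H : Subgroup G)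
    [H.Normal] (hH : IsStable φ H) (x : G) :
    quotientAut φ H hH (x : G ⧸ H) = ((φ x : G) : G ⧸ H) := rfl

/-! Call a compact subgroup `L ≤ φ L` expanded if the index `[L : L ∩ φ⁻¹ L]` is finite. The entropy
of `φ` is the supremum of `log [L : L ∩ φ⁻¹ L]` over the expanded subgroups. Indeed, the words of
length `n` in the cosets of `L ∩ φ⁻¹ L` in `L` can be realised by elements of `L` with uniformly
separated `φ`-orbits of length `n`, which bounds the entropy from below. For an upper bound, let `U`
be a compact open subgroup and let `Uₙ` be the elements whose orbit stays in `U` up to time `n`. By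
compactness `[Uₙ : Uₙ₊₁]` is eventually equal to the index of the expanded subgroup `U₊` of the
endpoints of backward orbits in `U`.

For an exact sequence `1 → N → G → Q → 1`, the index of an expanded subgroup of `G` is the product
of the indices of its trace on `N` and its image in `Q`, so `h(G) ≤ h(N) + h(Q)`. Conversely, words
in `N` and lifts of words in `Q` multiply to separated families in `G`. -/

section TopologicalEntropy

open Set Filter Function Topology Dynamics
open scoped Pointwise

variable {N G Q : Type*} [Group N] [Group G] [Group Q]

theorem relIndex_eq_of_le_of_subset_mul {H K L : Subgroup G} (hKL : K ≤ L)
    (hL : (L : Set G) ⊆ K * H) : H.relIndex L = H.relIndex K := by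
  have hsurj : Surjective (Subgroup.quotientSubgroupOfEmbeddingOfLE H hKL) := by
    rintro ⟨x, hx⟩
    obtain ⟨k, hk, h, hh, hkh⟩ := hL hx
    refine ⟨((⟨k, hk⟩ : K) : K ⧸ H.subgroupOf K), QuotientGroup.eq.2 ?_⟩
    simpa [Subgroup.mem_subgroupOf, ← hkh] using hh
  exact (Nat.card_congr (Equiv.ofBijective _ ⟨(Embedding.injective _), hsurj⟩)).symm

theorem relIndex_eq_relIndex_comap_mul_relIndex_map {ι : N →* G} {π : G →* Q}
    (hexact : ι.range = π.ker) {M L : Subgroup G} (hML : M ≤ L) :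
    M.relIndex L = (M.comap ι).relIndex (L.comap ι) * (M.map π).relIndex (L.map π) := by
  let M' := (M.map π).comap π
  have hmap : M'.relIndex L = (M.map π).relIndex (L.map π) := Subgroup.relIndex_comap ..
  have hcomap : (M.comap ι).relIndex (L.comap ι) = M.relIndex (L ⊓ π.ker) := by
    rw [Subgroup.relIndex_comap, Subgroup.map_comap_eq, hexact, inf_comm]
  have hproduct : ((M' ⊓ L : Subgroup G) : Set G) ⊆ (L ⊓ π.ker : Subgroup G) * M := by
    rintro x ⟨⟨m, hm, hmx⟩, hx⟩
    refine ⟨x * m⁻¹, ⟨L.mul_mem hx (L.inv_mem (hML hm)), ?_⟩, m, hm, inv_mul_cancel_right x m⟩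
    simp [hmx]
  have hker : L ⊓ π.ker ≤ M' ⊓ L := fun x ⟨hx, hxker⟩ ↦
    ⟨⟨1, one_mem M, (map_one π).trans hxker.symm⟩, hx⟩
  rw [hcomap, ← hmap, ← relIndex_eq_of_le_of_subset_mul hker hproduct,
    Subgroup.relIndex_inf_mul_relIndex, inf_of_le_left (Subgroup.le_comap_map π M)]

theorem isFiniteRelIndex_of_isOpen_of_isCompact [TopologicalSpace G] [IsTopologicalGroup G]
    {H K : Subgroup G} (hH : IsOpen (H : Set G)) (hK : IsCompact (K : Set G)) :
    H.IsFiniteRelIndex K := by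
  have : CompactSpace K := isCompact_iff_compactSpace.1 hK
  have : Finite (K ⧸ H.subgroupOf K) :=
    (H.subgroupOf K).quotient_finite_of_isOpen (hH.preimage continuous_subtype_val)
  exact ⟨Nat.card_pos.ne'⟩

theorem exists_mem_nhds_one_inter_subset [TopologicalSpace G] [IsTopologicalGroup G]
    {M L : Subgroup G} (hM : IsClosed (M : Set G)) [M.IsFiniteRelIndex L] :
    ∃ W ∈ 𝓝 (1 : G), (L : Set G) ∩ W ⊆ M := by
  have hopen : IsOpen (M.subgroupOf L : Set L) :=
    (M.subgroupOf L).isOpen_of_isClosed_of_finiteIndex (hM.preimage continuous_subtype_val)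
  obtain ⟨W, hW, hWM⟩ := (mem_nhds_subtype _ _ _).1 (hopen.mem_nhds (one_mem _))
  exact ⟨W, hW, fun x ⟨hx, hxW⟩ ↦ hWM (show (⟨x, hx⟩ : L) ∈ _ from hxW)⟩

theorem exists_isCompact_subset_image {X Y : Type*} [TopologicalSpace X] [TopologicalSpace Y]
    [WeaklyLocallyCompactSpace X] {f : X → Y} (hf : IsOpenQuotientMap f) {M : Set Y}
    (hM : IsCompact M) : ∃ K, IsCompact K ∧ M ⊆ f '' K := by
  choose s hs using hf.surjective
  choose C hC hCs using fun y ↦ exists_compact_mem_nhds (s y)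
  obtain ⟨t, -, ht⟩ := hM.elim_nhds_subcover (fun y ↦ f '' C y) fun y _ ↦ by
    simpa only [hs] using hf.isOpenMap.image_mem_nhds (hCs y)
  exact ⟨⋃ y ∈ t, C y, t.isCompact_biUnion fun y _ ↦ hC y, by rwa [image_iUnion₂]⟩

theorem nonarchimedeanGroup_of_totallyDisconnectedSpace [TopologicalSpace G] [IsTopologicalGroup G]
    [T2Space G] [LocallyCompactSpace G] [TotallyDisconnectedSpace G] :
    NonarchimedeanGroup G where
  is_nonarchimedean W hW := by
    obtain ⟨C, hC, hCW, hCc⟩ := local_compact_nhds hW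
    obtain ⟨V, hV, hV1, hVC⟩ := loc_compact_Haus_tot_disc_of_zero_dim.mem_nhds_iff.1 hC
    obtain ⟨T, hT, hTV⟩ := compact_open_separated_mul_left
      (hCc.of_isClosed_subset hV.isClosed hVC) hV.isOpen Subset.rfl
    have hstab : T ∩ T⁻¹ ⊆ MulAction.stabilizer G V := fun x ⟨hx, hx'⟩ ↦
      MulAction.mem_stabilizer_set.2 fun v ↦
        ⟨fun h ↦ by simpa using hTV (mul_mem_mul hx' h), fun h ↦ hTV (mul_mem_mul hx h)⟩
    refine ⟨⟨MulAction.stabilizer G V, Subgroup.isOpen_of_mem_nhds _ (g := 1)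
      (mem_of_superset (inter_mem hT (inv_mem_nhds_one G hT)) hstab)⟩, fun x hx ↦ hCW (hVC ?_)⟩
    simpa using (MulAction.mem_stabilizer_set.1 hx 1).2 hV1

theorem exists_isOpen_isCompact_subgroup_subset [TopologicalSpace G] [NonarchimedeanGroup G]
    [LocallyCompactSpace G] {W : Set G} (hW : W ∈ 𝓝 1) :
    ∃ U : Subgroup G, IsOpen (U : Set G) ∧ IsCompact (U : Set G) ∧ (U : Set G) ⊆ W := by
  obtain ⟨C, hC, hCW, hCc⟩ := local_compact_nhds hW
  obtain ⟨U, hUC⟩ := NonarchimedeanGroup.is_nonarchimedean C hC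
  exact ⟨U, U.isOpen, hCc.of_isClosed_subset U.isClosed hUC, hUC.trans hCW⟩

theorem nonarchimedeanGroup_of_isOpenQuotientMap [TopologicalSpace G] [NonarchimedeanGroup G]
    [TopologicalSpace Q] [IsTopologicalGroup Q] {π : G →* Q} (hπ : IsOpenQuotientMap π) :
    NonarchimedeanGroup Q where
  is_nonarchimedean W hW := by
    obtain ⟨U, hU⟩ := NonarchimedeanGroup.is_nonarchimedean (π ⁻¹' W)
      (hπ.continuous.continuousAt.preimage_mem_nhds (by rwa [map_one]))
    exact ⟨⟨U.toSubgroup.map π, hπ.isOpenMap _ U.isOpen⟩, image_subset_iff.2 hU⟩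

theorem nonarchimedeanGroup_of_isInducing [TopologicalSpace N] [IsTopologicalGroup N]
    [TopologicalSpace G] [NonarchimedeanGroup G] {ι : N →* G} (hι : IsInducing ι) :
    NonarchimedeanGroup N where
  is_nonarchimedean W hW := by
    rw [hι.nhds_eq_comap, map_one] at hW
    obtain ⟨V, hV, hVW⟩ := hW
    obtain ⟨U, hU⟩ := NonarchimedeanGroup.is_nonarchimedean V hV
    exact ⟨U.comap ι hι.continuous, (preimage_mono hU).trans hVW⟩

theorem t2Space_of_isQuotientMap_of_isClosed_ker [TopologicalSpace G] [TopologicalSpace Q]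
    [IsTopologicalGroup Q] {π : G →* Q} (hπ : IsQuotientMap π) (hker : IsClosed (π.ker : Set G)) :
    T2Space Q := by
  have : T1Space Q := IsTopologicalGroup.t1Space Q (hπ.isClosed_preimage.1 hker)
  infer_instance

/-- The entourage of the left uniformity of a group attached to a neighbourhood `V` of `1`. -/
def leftEntourage (V : Set G) : SetRel G G :=
  {p | p.1⁻¹ * p.2 ∈ V}

theorem groupTopEntropy_le_of_forall_exists_subset [TopologicalSpace G] [IsTopologicalGroup G]
    {f : G → G} {a : EReal}
    (h : ∀ W ∈ 𝓝 (1 : G), ∃ V ⊆ W, ∀ K, IsCompact K →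
      coverEntropyEntourage f K (leftEntourage V) ≤ a) : groupTopEntropy f ≤ a := by
  let := IsTopologicalGroup.leftUniformSpace G
  refine iSup₂_le fun K hK ↦ iSup₂_le fun U hU ↦ ?_
  obtain ⟨W, hW, hWU⟩ := mem_comap.1 hU
  obtain ⟨V, hVW, hV⟩ := h W hW
  exact (coverEntropyEntourage_antitone f K fun p hp ↦ hWU (hVW hp)).trans (hV K hK)

theorem netEntropyEntourage_leftEntourage_le_groupTopEntropy [TopologicalSpace G]
    [IsTopologicalGroup G] (f : G → G) {K V : Set G} (hK : IsCompact K) (hV : V ∈ 𝓝 1) :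
    netEntropyEntourage f K (leftEntourage V) ≤ groupTopEntropy f := by
  let := IsTopologicalGroup.leftUniformSpace G
  exact (netEntropyEntourage_le_coverEntropy f K (preimage_mem_comap hV)).trans
    (le_iSup₂ (f := fun (K : Set G) (_ : IsCompact K) ↦ coverEntropy f K) K hK)

/-- A family of elements of a group whose `f`-orbits of length `n` are pairwise `W`-apart for the
left uniformity. As `f` will be an endomorphism, only the orbits of the quotients matter. -/
def IsSeparatedFamily (f : G → G) (W : Set G) (n : ℕ) {α : Type*} (x : α → G) : Prop :=
  Pairwise fun i j ↦ ∃ k < n, f^[k] ((x i)⁻¹ * x j) ∉ W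

namespace IsSeparatedFamily

theorem injective {φ : G →* G} {W : Set G} {n : ℕ} {α : Type*} {x : α → G}
    (hx : IsSeparatedFamily φ W n x) (hW : 1 ∈ W) : Injective x := fun i j hij ↦ by
  by_contra hne
  obtain ⟨k, -, hk⟩ := hx hne
  rw [hij, inv_mul_cancel, iterate_map_one] at hk
  exact hk hW

theorem mono {f : G → G} {V W : Set G} {n : ℕ} {α : Type*} {x : α → G}
    (hx : IsSeparatedFamily f W n x) (hVW : V ⊆ W) : IsSeparatedFamily f V n x :=
  fun _ _ hij ↦ (hx hij).imp fun _ ⟨hk, hkW⟩ ↦ ⟨hk, notMem_subset hVW hkW⟩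

theorem comp_injective {f : G → G} {W : Set G} {n : ℕ} {α β : Type*}
    {x : α → G} (hx : IsSeparatedFamily f W n x) {e : β → α} (he : Injective e) :
    IsSeparatedFamily f W n (x ∘ e) :=
  hx.comp_of_injective he

theorem card_le_netMaxcard {φ : G →* G} {W V : Set G} {n : ℕ} {α : Type*}
    [Finite α] {x : α → G} (hx : IsSeparatedFamily φ W n x) {K : Set G} (hxK : ∀ i, x i ∈ K)
    (hW : 1 ∈ W) (hV : ∀ v ∈ V, ∀ w ∈ V, v / w ∈ W) :
    (Nat.card α : ℕ∞) ≤ netMaxcard φ K (leftEntourage V) n := by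
  have := Fintype.ofFinite α
  have hnet : IsDynNetIn φ K (leftEntourage V) n
      (Finset.univ.map ⟨x, hx.injective hW⟩ : Finset G) := by
    refine ⟨by simpa [range_subset_iff] using hxK, ?_⟩
    simp only [Finset.coe_map, Finset.coe_univ, image_univ, Embedding.coeFn_mk]
    rintro _ ⟨i, rfl⟩ _ ⟨j, rfl⟩ hij
    refine disjoint_left.2 fun z hzi hzj ↦ ?_
    obtain ⟨k, hkn, hk⟩ := hx (ne_of_apply_ne x hij)
    have hi : (φ^[k] (x i))⁻¹ * φ^[k] z ∈ V := mem_dynEntourage.1 hzi k hkn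
    have hj : (φ^[k] (x j))⁻¹ * φ^[k] z ∈ V := mem_dynEntourage.1 hzj k hkn
    refine hk ?_
    rw [iterate_map_mul, iterate_map_inv]
    simpa [div_eq_mul_inv, mul_assoc] using hV _ hi _ hj
  simpa using hnet.card_le_netMaxcard

theorem mul {φ : G →* G} {ψ : N → N} {χ : Q → Q} {ι : N →* G} {π : G →* Q}
    (hιφ : Semiconj ι ψ φ) (hπφ : Semiconj π φ χ)
    (hπι : ∀ a, π (ι a) = 1) {W : Set G} {W' : Set Q} {n : ℕ} {α β : Type*} {x : α → N}
    {y : β → G} (hx : IsSeparatedFamily ψ (ι ⁻¹' W) n x)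
    (hy : IsSeparatedFamily χ W' n (π ∘ y)) :
    IsSeparatedFamily φ (W ∩ π ⁻¹' W') n fun p : α × β ↦ y p.2 * ι (x p.1) := by
  rintro ⟨i, i'⟩ ⟨j, j'⟩ hij
  by_cases h : i' = j'
  · subst h
    obtain ⟨k, hk, hkW⟩ := hx fun h : i = j ↦ hij (by rw [h])
    refine ⟨k, hk, fun hmem ↦ hkW ?_⟩
    rw [mem_preimage, hιφ.iterate_right k]
    simpa [mul_assoc] using hmem.1
  · obtain ⟨k, hk, hkW⟩ := hy h
    refine ⟨k, hk, fun hmem ↦ hkW ?_⟩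
    have := hmem.2
    rw [mem_preimage, hπφ.iterate_right k] at this
    simpa [hπι, mul_assoc] using this

end IsSeparatedFamily

theorem log_natCard_le_groupTopEntropy [TopologicalSpace G] [IsTopologicalGroup G]
    {φ : G →* G} {K W : Set G} (hK : IsCompact K) (hW : W ∈ 𝓝 1) {α : Type*} [Finite α]
    (h : ∀ n, ∃ x : (Fin n → α) → G, (∀ w, x w ∈ K) ∧ IsSeparatedFamily φ W n x) :
    ENNReal.log (Nat.card α) ≤ groupTopEntropy φ := by
  obtain ⟨V, hV, hVW⟩ := exists_nhds_split_inv hW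
  refine le_trans ?_ (netEntropyEntourage_leftEntourage_le_groupTopEntropy φ hK hV)
  rw [← ExpGrowth.expGrowthSup_pow]
  refine ExpGrowth.expGrowthSup_monotone fun n ↦ ?_
  obtain ⟨x, hxK, hx⟩ := h n
  have := ENat.toENNReal_mono (hx.card_le_netMaxcard hxK (mem_of_mem_nhds hW) hVW)
  simpa [Nat.card_fun] using this

theorem exists_isSeparatedFamily_words {φ : G →* G} {L : Subgroup G}
    (hL : L ≤ L.map φ) {W : Set G} (hW : (L : Set G) ∩ W ⊆ L.comap φ) (n : ℕ) :
    ∃ x : (Fin n → L ⧸ (L.comap φ).subgroupOf L) → G,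
      (∀ w, x w ∈ L) ∧ IsSeparatedFamily φ W n x := by
  choose! σ hσL hσ using show ∀ y ∈ L, ∃ x ∈ L, φ x = y from hL
  induction n with
  | zero => exact ⟨fun _ ↦ 1, fun _ ↦ one_mem L, fun w w' h ↦ (h (Subsingleton.elim w w')).elim⟩
  | succ n ih =>
    obtain ⟨x, hxL, hx⟩ := ih
    refine ⟨fun w ↦ (w 0).out * σ (x (Fin.tail w)),
      fun w ↦ mul_mem (w 0).out.2 (hσL _ (hxL _)), fun w w' hw ↦ ?_⟩
    by_cases h0 : w 0 = w' 0
    · have htail : Fin.tail w ≠ Fin.tail w' := fun h ↦ hw <| by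
        rw [← Fin.cons_self_tail w, ← Fin.cons_self_tail w', h0, h]
      obtain ⟨k, hk, hkW⟩ := hx htail
      refine ⟨k + 1, by lia, ?_⟩
      rw [iterate_succ_apply]
      simpa [h0, mul_assoc, hσ _ (hxL _)] using hkW
    · refine ⟨0, n.succ_pos, fun hmem ↦ h0 ?_⟩
      rw [← QuotientGroup.out_eq' (w 0), ← QuotientGroup.out_eq' (w' 0), QuotientGroup.eq,
        Subgroup.mem_subgroupOf, Subgroup.mem_comap]
      have hquot := hW ⟨mul_mem (inv_mem (mul_mem (w 0).out.2 (hσL _ (hxL _))))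
        (mul_mem (w' 0).out.2 (hσL _ (hxL _))), hmem⟩
      have hφ := mul_mem (mul_mem (hxL (Fin.tail w)) hquot) (inv_mem (hxL (Fin.tail w')))
      simpa [mul_assoc, hσ _ (hxL _)] using hφ

/-- A compact subgroup `L` with `L ≤ φ L` in which `L ∩ φ⁻¹ L` has finite index. These are the
subgroups whose expansion indices compute the entropy of `φ`. -/
structure IsExpanded [TopologicalSpace G] (φ : G →* G) (L : Subgroup G) : Prop where
  isCompact : IsCompact (L : Set G)
  le_map : L ≤ L.map φ
  isFiniteRelIndex : (L.comap φ).IsFiniteRelIndex L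

/-- The index `[L : L ∩ φ⁻¹ L]`, which is `[φ L : L]` when `φ` is injective and `L ≤ φ L`. -/
noncomputable def expansionIndex (φ : G →* G) (L : Subgroup G) : ℕ :=
  (L.comap φ).relIndex L

namespace IsExpanded

section Entropy

variable [TopologicalSpace G] [IsTopologicalGroup G] [T2Space G]
  {φ : G →* G} {L : Subgroup G}

theorem exists_isSeparatedFamily (hL : IsExpanded φ L) (hφ : Continuous φ) :
    ∃ W ∈ 𝓝 (1 : G), ∀ n, ∃ x : (Fin n → Fin (expansionIndex φ L)) → G,
      (∀ w, x w ∈ L) ∧ IsSeparatedFamily φ W n x := by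
  have := hL.isFiniteRelIndex
  obtain ⟨W, hW, hWL⟩ :=
    exists_mem_nhds_one_inter_subset (M := L.comap φ) (L := L) (hL.isCompact.isClosed.preimage hφ)
  refine ⟨W, hW, fun n ↦ ?_⟩
  obtain ⟨x, hxL, hx⟩ := exists_isSeparatedFamily_words hL.le_map hWL n
  let e : Fin (expansionIndex φ L) ≃ L ⧸ (L.comap φ).subgroupOf L :=
    (Finite.equivFinOfCardEq rfl).symm
  exact ⟨_, fun w ↦ hxL _, hx.comp_injective (e := (e ∘ ·)) e.injective.comp_left⟩

theorem log_expansionIndex_le_groupTopEntropy (hL : IsExpanded φ L) (hφ : Continuous φ) :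
    ENNReal.log (expansionIndex φ L) ≤ groupTopEntropy φ := by
  obtain ⟨W, hW, hx⟩ := hL.exists_isSeparatedFamily hφ
  simpa using log_natCard_le_groupTopEntropy hL.isCompact hW hx

end Entropy

theorem log_add_log_le_groupTopEntropy [TopologicalSpace N] [IsTopologicalGroup N] [T2Space N]
    [TopologicalSpace G] [IsTopologicalGroup G] [WeaklyLocallyCompactSpace G]
    [TopologicalSpace Q] [IsTopologicalGroup Q] [T2Space Q]
    {φ : G →* G} {ψ : N →* N} {χ : Q →* Q} {ι : N →* G} {π : G →* Q} (hψ : Continuous ψ)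
    (hχ : Continuous χ) (hι : IsInducing ι) (hπ : IsOpenQuotientMap π)
    (hπι : ∀ a, π (ι a) = 1) (hιφ : Semiconj ι ψ φ) (hπφ : Semiconj π φ χ)
    {L : Subgroup N} {M : Subgroup Q} (hL : IsExpanded ψ L) (hM : IsExpanded χ M) :
    ENNReal.log (expansionIndex ψ L) + ENNReal.log (expansionIndex χ M) ≤ groupTopEntropy φ := by
  obtain ⟨V, hV, hx⟩ := hL.exists_isSeparatedFamily hψ
  obtain ⟨W', hW', hy⟩ := hM.exists_isSeparatedFamily hχ
  obtain ⟨K, hK, hMK⟩ := exists_isCompact_subset_image hπ hM.isCompact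
  obtain ⟨W, hW, hWV⟩ : ∃ W ∈ 𝓝 (1 : G), ι ⁻¹' W ⊆ V := by
    rwa [hι.nhds_eq_comap, map_one] at hV
  have hWW' : W ∩ π ⁻¹' W' ∈ 𝓝 1 :=
    inter_mem hW (hπ.continuous.continuousAt.preimage_mem_nhds (by rwa [map_one]))
  suffices h : ∀ n, ∃ x : (Fin n → Fin (expansionIndex ψ L) × Fin (expansionIndex χ M)) → G,
      (∀ w, x w ∈ K * ι '' L) ∧ IsSeparatedFamily φ (W ∩ π ⁻¹' W') n x by
    simpa [ENNReal.log_mul_add] using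
      log_natCard_le_groupTopEntropy (hK.mul (hL.isCompact.image hι.continuous)) hWW' h
  intro n
  obtain ⟨x, hxL, hx⟩ := hx n
  obtain ⟨y, hyM, hy⟩ := hy n
  choose z hzK hzy using fun w ↦ hMK (hyM w)
  have hz : IsSeparatedFamily χ W' n (π ∘ z) := (funext hzy : π ∘ z = y) ▸ hy
  exact ⟨_, fun w ↦ mul_mem_mul (hzK _) ⟨_, hxL _, rfl⟩,
    ((hx.mono hWV).mul hιφ hπφ hπι hz).comp_injective
      (Equiv.arrowProdEquivProdArrow _ _ _).injective⟩

end IsExpanded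

section Cotrajectory

variable (φ : G →* G) (U : Subgroup G)

/-- The `φ`-cotrajectory of `U`: the elements whose `φ`-orbit stays in `U` up to and including
time `n`. -/
def cotrajectory (n : ℕ) : Subgroup G where
  carrier := {x | ∀ k ≤ n, φ^[k] x ∈ U}
  mul_mem' hx hy k hk := by rw [iterate_map_mul]; exact mul_mem (hx k hk) (hy k hk)
  one_mem' k _ := by rw [iterate_map_one]; exact one_mem U
  inv_mem' hx k hk := by rw [iterate_map_inv]; exact inv_mem (hx k hk)

/-- The iterate `φ^[n]` as a homomorphism, along which subgroups can be mapped and pulled back. -/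
def iterateHom (n : ℕ) : G →* G where
  toFun := φ^[n]
  map_one' := iterate_map_one φ n
  map_mul' := iterate_map_mul φ n

/-- The points reached at time `n` by the `φ`-orbits that stay in `U` up to time `n`. -/
def trajectoryEnds (n : ℕ) : Subgroup G :=
  (cotrajectory φ U n).map (iterateHom φ n)

/-- The points of `U` reached at time `n`, for every `n`, by `φ`-orbits that stay in `U`. It plays
the role of the subgroup `U₊` of Willis' theory of tidy subgroups. -/
def plusSubgroup : Subgroup G :=
  ⨅ n, trajectoryEnds φ U n

variable {φ U}

theorem cotrajectory_antitone : Antitone (cotrajectory φ U) :=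
  fun _ _ hmn _ hx k hk ↦ hx k (hk.trans hmn)

theorem cotrajectory_le (n : ℕ) : cotrajectory φ U n ≤ U := fun _ hx ↦ hx 0 n.zero_le

theorem mem_cotrajectory_succ {n : ℕ} {x : G} :
    x ∈ cotrajectory φ U (n + 1) ↔ x ∈ cotrajectory φ U n ∧ φ^[n + 1] x ∈ U :=
  ⟨fun hx ↦ ⟨fun k hk ↦ hx k (hk.trans n.le_succ), hx _ le_rfl⟩,
    fun hx k hk ↦ (Nat.le_succ_iff.1 hk).elim (hx.1 k) fun h ↦ h ▸ hx.2⟩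

theorem mem_trajectoryEnds {n : ℕ} {y : G} :
    y ∈ trajectoryEnds φ U n ↔ ∃ x ∈ cotrajectory φ U n, φ^[n] x = y := Iff.rfl

theorem trajectoryEnds_zero : trajectoryEnds φ U 0 = U := by
  ext y
  simp [mem_trajectoryEnds, cotrajectory]

theorem trajectoryEnds_succ (n : ℕ) :
    trajectoryEnds φ U (n + 1) = U ⊓ (trajectoryEnds φ U n).map φ := by
  ext y
  simp only [Subgroup.mem_inf, Subgroup.mem_map, mem_trajectoryEnds, mem_cotrajectory_succ,
    iterate_succ_apply']
  constructor
  · rintro ⟨x, ⟨hx, hxU⟩, rfl⟩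
    exact ⟨hxU, _, ⟨x, hx, rfl⟩, rfl⟩
  · rintro ⟨hyU, _, ⟨x, hx, rfl⟩, rfl⟩
    exact ⟨x, ⟨hx, hyU⟩, rfl⟩

theorem trajectoryEnds_antitone : Antitone (trajectoryEnds φ U) := by
  refine antitone_nat_of_succ_le fun n ↦ ?_
  induction n with
  | zero => exact ((trajectoryEnds_succ 0).trans_le inf_le_left).trans_eq trajectoryEnds_zero.symm
  | succ n ih =>
    exact ((trajectoryEnds_succ _).trans_le (inf_le_inf_left U (Subgroup.map_mono ih))).trans_eq
      (trajectoryEnds_succ n).symm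

theorem plusSubgroup_le : plusSubgroup φ U ≤ U :=
  (iInf_le _ 0).trans_eq trajectoryEnds_zero

theorem comap_plusSubgroup_inf :
    (plusSubgroup φ U).comap φ ⊓ plusSubgroup φ U = U.comap φ ⊓ plusSubgroup φ U := by
  refine le_antisymm (inf_le_inf_right _ (Subgroup.comap_mono plusSubgroup_le))
    fun x ⟨hxU, hx⟩ ↦ ⟨Subgroup.mem_iInf.2 fun n ↦ ?_, hx⟩
  apply trajectoryEnds_antitone n.le_succ
  rw [Nat.succ_eq_add_one, trajectoryEnds_succ]
  exact ⟨hxU, x, Subgroup.mem_iInf.1 hx n, rfl⟩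

theorem expansionIndex_plusSubgroup :
    expansionIndex φ (plusSubgroup φ U) = (U.comap φ).relIndex (plusSubgroup φ U) := by
  rw [expansionIndex, ← Subgroup.inf_relIndex_right, comap_plusSubgroup_inf,
    Subgroup.inf_relIndex_right]

theorem relIndex_cotrajectory_succ (n : ℕ) :
    (cotrajectory φ U (n + 1)).relIndex (cotrajectory φ U n) =
      (U.comap φ).relIndex (trajectoryEnds φ U n) := by
  have hsucc : cotrajectory φ U (n + 1) =
      (U.comap φ).comap (iterateHom φ n) ⊓ cotrajectory φ U n := by
    ext x
    rw [mem_cotrajectory_succ, and_comm, iterate_succ_apply']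
    rfl
  rw [hsucc, Subgroup.inf_relIndex_right, Subgroup.relIndex_comap, trajectoryEnds]

theorem coe_cotrajectory (n : ℕ) :
    (cotrajectory φ U n : Set G) = ⋂ k ∈ Iic n, φ^[k] ⁻¹' U := by
  ext
  simp [cotrajectory]

variable [TopologicalSpace G]

theorem isOpen_cotrajectory (hφ : Continuous φ) (hU : IsOpen (U : Set G)) (n : ℕ) :
    IsOpen (cotrajectory φ U n : Set G) := by
  rw [coe_cotrajectory]
  exact (finite_Iic n).isOpen_biInter fun k _ ↦ hU.preimage (hφ.iterate k)

theorem isCompact_cotrajectory [T2Space G] (hφ : Continuous φ) (hU : IsCompact (U : Set G))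
    (n : ℕ) : IsCompact (cotrajectory φ U n : Set G) := by
  refine hU.of_isClosed_subset ?_ (cotrajectory_le n)
  rw [coe_cotrajectory]
  exact isClosed_biInter fun k _ ↦ hU.isClosed.preimage (hφ.iterate k)

theorem isCompact_trajectoryEnds [T2Space G] (hφ : Continuous φ) (hU : IsCompact (U : Set G))
    (n : ℕ) : IsCompact (trajectoryEnds φ U n : Set G) :=
  (isCompact_cotrajectory hφ hU n).image (hφ.iterate n)

theorem isCompact_plusSubgroup [T2Space G] (hφ : Continuous φ) (hU : IsCompact (U : Set G)) :
    IsCompact (plusSubgroup φ U : Set G) := by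
  rw [plusSubgroup, Subgroup.coe_iInf]
  exact (isCompact_trajectoryEnds hφ hU 0).of_isClosed_subset
    (isClosed_iInter fun n ↦ (isCompact_trajectoryEnds hφ hU n).isClosed) (iInter_subset _ 0)

theorem plusSubgroup_le_map [T2Space G] (hφ : Continuous φ) (hU : IsCompact (U : Set G)) :
    plusSubgroup φ U ≤ (plusSubgroup φ U).map φ := fun y hy ↦ by
  have hcompact (n : ℕ) : IsCompact (φ ⁻¹' {y} ∩ trajectoryEnds φ U n) :=
    (isCompact_trajectoryEnds hφ hU n).inter_left (isClosed_singleton.preimage hφ)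
  have hnonempty (n : ℕ) : (φ ⁻¹' {y} ∩ trajectoryEnds φ U n).Nonempty := by
    have hyn := Subgroup.mem_iInf.1 hy (n + 1)
    rw [trajectoryEnds_succ] at hyn
    obtain ⟨-, x, hx, hxy⟩ := hyn
    exact ⟨x, hxy, hx⟩
  obtain ⟨x, hx⟩ := IsCompact.nonempty_iInter_of_sequence_nonempty_isCompact_isClosed _
    (fun n ↦ inter_subset_inter_right _ (trajectoryEnds_antitone n.le_succ)) hnonempty
    (hcompact 0) fun n ↦ (hcompact n).isClosed
  rw [mem_iInter] at hx
  exact ⟨x, Subgroup.mem_iInf.2 fun n ↦ (hx n).2, (hx 0).1⟩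

variable [IsTopologicalGroup G] [T2Space G]

theorem isExpanded_plusSubgroup (hφ : Continuous φ) (hUo : IsOpen (U : Set G))
    (hUc : IsCompact (U : Set G)) : IsExpanded φ (plusSubgroup φ U) where
  isCompact := isCompact_plusSubgroup hφ hUc
  le_map := plusSubgroup_le_map hφ hUc
  isFiniteRelIndex := by
    have := isFiniteRelIndex_of_isOpen_of_isCompact (H := U.comap φ) (hUo.preimage hφ)
      (isCompact_plusSubgroup hφ hUc)
    exact ⟨expansionIndex_plusSubgroup.trans_ne this.relIndex_ne_zero⟩

theorem eventually_relIndex_trajectoryEnds_eq (hφ : Continuous φ) (hUo : IsOpen (U : Set G))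
    (hUc : IsCompact (U : Set G)) :
    ∀ᶠ n in atTop, (U.comap φ).relIndex (trajectoryEnds φ U n) =
      expansionIndex φ (plusSubgroup φ U) := by
  have hopen : IsOpen ((plusSubgroup φ U : Set G) * (U.comap φ : Set G)) :=
    (hUo.preimage hφ).mul_left
  obtain ⟨n₀, hn₀⟩ := exists_subset_nhds_of_isCompact (V := fun n ↦ (trajectoryEnds φ U n : Set G))
    (U := (plusSubgroup φ U : Set G) * (U.comap φ : Set G))
    (Antitone.directed_ge trajectoryEnds_antitone) (isCompact_trajectoryEnds hφ hUc)
    (fun x hx ↦ hopen.mem_nhds ⟨x, by simpa [plusSubgroup] using hx, 1, one_mem _, mul_one x⟩)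
  filter_upwards [eventually_ge_atTop n₀] with n hn
  rw [expansionIndex_plusSubgroup]
  exact relIndex_eq_of_le_of_subset_mul (iInf_le _ n)
    (Subset.trans (trajectoryEnds_antitone hn) hn₀)

theorem exists_relIndex_cotrajectory_add_eq (hφ : Continuous φ) (hUo : IsOpen (U : Set G))
    (hUc : IsCompact (U : Set G)) :
    ∃ n₀, ∀ m, (cotrajectory φ U (n₀ + m)).relIndex (cotrajectory φ U n₀) =
      expansionIndex φ (plusSubgroup φ U) ^ m := by
  obtain ⟨n₀, hn₀⟩ := eventually_atTop.1 (eventually_relIndex_trajectoryEnds_eq hφ hUo hUc)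
  refine ⟨n₀, fun m ↦ ?_⟩
  induction m with
  | zero => simp
  | succ m ih =>
    rw [← Subgroup.relIndex_mul_relIndex _ (cotrajectory φ U (n₀ + m)) _
      (cotrajectory_antitone (by lia)) (cotrajectory_antitone (by lia)), ih, ← add_assoc,
      relIndex_cotrajectory_succ, hn₀ _ (by lia), pow_succ']

end Cotrajectory

theorem coverMincard_leftEntourage_le {φ : G →* G} {K V : Set G}
    {D P : Subgroup G} [D.IsFiniteRelIndex P] {t : Finset G}
    (hK : K ⊆ ⋃ g ∈ t, g • (P : Set G)) {n : ℕ} (hD : ∀ d ∈ D, ∀ k < n, φ^[k] d ∈ V) :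
    coverMincard φ K (leftEntourage V) n ≤ (t.card * D.relIndex P : ℕ) := by
  classical
  have := Fintype.ofFinite (P ⧸ D.subgroupOf P)
  let S : Finset G := Finset.image₂ (fun g (q : P ⧸ D.subgroupOf P) ↦ g * q.out) t Finset.univ
  have hS : IsDynCoverOf φ K (leftEntourage V) n S := by
    intro x hx
    obtain ⟨g, hg, p, hp, rfl⟩ := mem_iUnion₂.1 (hK hx)
    let q : P ⧸ D.subgroupOf P := (⟨p, hp⟩ : P)
    refine ⟨g * q.out, Finset.mem_image₂_of_mem hg (Finset.mem_univ q),
      mem_dynEntourage.2 fun k hk ↦ ?_⟩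
    have hq : p⁻¹ * q.out ∈ D := Subgroup.mem_subgroupOf.1
      (QuotientGroup.eq.1 (QuotientGroup.out_eq' q).symm)
    simpa [leftEntourage, ← iterate_map_inv, ← iterate_map_mul, mul_assoc] using hD _ hq k hk
  refine hS.coverMincard_le_card.trans (Nat.cast_le.2 (Finset.card_image₂_le ..|>.trans_eq ?_))
  rw [Finset.card_univ, ← Nat.card_eq_fintype_card]
  rfl

theorem coverEntropyEntourage_le_log_expansionIndex [TopologicalSpace G] [IsTopologicalGroup G]
    [T2Space G] {φ : G →* G} (hφ : Continuous φ) {U : Subgroup G}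
    (hUo : IsOpen (U : Set G)) (hUc : IsCompact (U : Set G)) {K : Set G} (hK : IsCompact K) :
    coverEntropyEntourage φ K (leftEntourage (U : Set G)) ≤
      ENNReal.log (expansionIndex φ (plusSubgroup φ U)) := by
  obtain ⟨n₀, hn₀⟩ := exists_relIndex_cotrajectory_add_eq hφ hUo hUc
  have hpos : 0 < expansionIndex φ (plusSubgroup φ U) := Nat.pos_of_ne_zero
    (isExpanded_plusSubgroup hφ hUo hUc).isFiniteRelIndex.relIndex_ne_zero
  obtain ⟨t, -, ht⟩ := hK.elim_nhds_subcover (fun x ↦ x • (cotrajectory φ U n₀ : Set G))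
    fun x _ ↦ ((isOpen_cotrajectory hφ hUo n₀).smul x).mem_nhds ⟨1, one_mem _, mul_one x⟩
  have hcover (m : ℕ) : coverMincard φ K (leftEntourage (U : Set G)) (n₀ + m) ≤
      (t.card * expansionIndex φ (plusSubgroup φ U) ^ m : ℕ) := by
    have := isFiniteRelIndex_of_isOpen_of_isCompact (isOpen_cotrajectory hφ hUo (n₀ + m))
      (isCompact_cotrajectory hφ hUc n₀)
    rw [← hn₀]
    exact coverMincard_leftEntourage_le ht fun d hd k hk ↦ hd k hk.le
  rw [← ExpGrowth.expGrowthSup_pow]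
  refine ExpGrowth.expGrowthSup_le_of_eventually_le (ENNReal.natCast_ne_top t.card)
    (eventually_atTop.2 ⟨n₀, fun n hn ↦ ?_⟩)
  obtain ⟨m, rfl⟩ := Nat.exists_eq_add_of_le hn
  have hbound := ENat.toENNReal_mono ((hcover m).trans (Nat.cast_le.2 (Nat.mul_le_mul_left t.card
    (Nat.pow_le_pow_right hpos (Nat.le_add_left m n₀)))))
  simpa using hbound

theorem groupTopEntropy_eq_iSup [TopologicalSpace G] [NonarchimedeanGroup G]
    [LocallyCompactSpace G] [T2Space G] {φ : G →* G} (hφ : Continuous φ) :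
    groupTopEntropy φ =
      ⨆ (L : Subgroup G) (_ : IsExpanded φ L), ENNReal.log (expansionIndex φ L) := by
  refine le_antisymm (groupTopEntropy_le_of_forall_exists_subset fun W hW ↦ ?_)
    (iSup₂_le fun L hL ↦ hL.log_expansionIndex_le_groupTopEntropy hφ)
  obtain ⟨U, hUo, hUc, hUW⟩ := exists_isOpen_isCompact_subgroup_subset hW
  exact ⟨U, hUW, fun K hK ↦ (coverEntropyEntourage_le_log_expansionIndex hφ hUo hUc hK).trans
    (le_iSup₂_of_le _ (isExpanded_plusSubgroup hφ hUo hUc) le_rfl)⟩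

section ExactSequence

variable {φ : G →* G} {ψ : N →* N} {χ : Q →* Q}
  {ι : N →* G} {π : G →* Q} {L : Subgroup G}

theorem comap_comap_of_semiconj (hιφ : Semiconj ι ψ φ) (L : Subgroup G) :
    (L.comap ι).comap ψ = (L.comap φ).comap ι := by
  ext x
  simp [hιφ.eq]

theorem comap_map_inf_map_of_semiconj (hπφ : Semiconj π φ χ) (hχ : Injective χ)
    (hL : L ≤ L.map φ) :
    (L.map π).comap χ ⊓ L.map π = (L.comap φ ⊓ L).map π := by
  ext q
  constructor
  · rintro ⟨⟨l, hl, hlq⟩, -⟩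
    obtain ⟨l', hl', rfl⟩ := hL hl
    exact ⟨l', ⟨hl, hl'⟩, hχ ((hπφ l').symm.trans hlq)⟩
  · rintro ⟨l, ⟨hφl, hl⟩, rfl⟩
    exact ⟨⟨φ l, hφl, hπφ l⟩, l, hl, rfl⟩

theorem expansionIndex_eq_mul (hexact : ι.range = π.ker) (hιφ : Semiconj ι ψ φ)
    (hπφ : Semiconj π φ χ) (hχ : Injective χ) (hL : L ≤ L.map φ) :
    expansionIndex φ L = expansionIndex ψ (L.comap ι) * expansionIndex χ (L.map π) := by
  unfold expansionIndex
  rw [comap_comap_of_semiconj hιφ, ← Subgroup.inf_relIndex_right (L.comap φ),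
    relIndex_eq_relIndex_comap_mul_relIndex_map hexact inf_le_right,
    ← comap_map_inf_map_of_semiconj hπφ hχ hL, Subgroup.comap_inf, Subgroup.inf_relIndex_right,
    Subgroup.inf_relIndex_right]

namespace IsExpanded

variable [TopologicalSpace N] [TopologicalSpace G]

theorem comap (hL : IsExpanded φ L) (hι : IsClosedEmbedding ι) (hexact : ι.range = π.ker)
    (hιφ : Semiconj ι ψ φ) (hπφ : Semiconj π φ χ) (hχ : Injective χ) :
    IsExpanded ψ (L.comap ι) where
  isCompact := hι.isCompact_preimage hL.isCompact
  le_map x hx := by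
    obtain ⟨l, hl, hlx⟩ := hL.le_map hx
    have hπl : π l = 1 := hχ <| by
      rw [← hπφ, hlx, map_one]
      exact hexact.le ⟨x, rfl⟩
    obtain ⟨y, rfl⟩ := hexact.ge hπl
    exact ⟨y, hl, hι.injective ((hιφ y).trans hlx)⟩
  isFiniteRelIndex := by
    rw [comap_comap_of_semiconj hιφ]
    exact ⟨Subgroup.relIndex_comap_ne_zero ι hL.isFiniteRelIndex.relIndex_ne_zero⟩

theorem map [TopologicalSpace Q] (hL : IsExpanded φ L) (hπ : Continuous π) (hπφ : Semiconj π φ χ) :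
    IsExpanded χ (L.map π) where
  isCompact := hL.isCompact.image hπ
  le_map := by
    rintro _ ⟨l, hl, rfl⟩
    obtain ⟨l', hl', rfl⟩ := hL.le_map hl
    exact ⟨π l', ⟨l', hl', rfl⟩, (hπφ l').symm⟩
  isFiniteRelIndex := by
    have := hL.isFiniteRelIndex
    have hle : L.comap φ ≤ ((L.map π).comap χ).comap π := fun x hx ↦ ⟨φ x, hx, hπφ x⟩
    rw [Subgroup.isFiniteRelIndex_iff_relIndex_ne_zero, ← Subgroup.relIndex_comap]
    exact (Subgroup.isFiniteRelIndex_of_le_left L hle).relIndex_ne_zero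

end IsExpanded

theorem mainTheorem2_general [TopologicalSpace N] [TopologicalSpace G] [TopologicalSpace Q]
    [IsTopologicalGroup N] [IsTopologicalGroup G] [IsTopologicalGroup Q] [T2Space G]
    [LocallyCompactSpace G] [TotallyDisconnectedSpace G] (hφ : Continuous φ)
    (hι : IsClosedEmbedding ι) (hπ : IsOpenQuotientMap π) (hexact : ι.range = π.ker)
    (hιφ : Semiconj ι ψ φ) (hπφ : Semiconj π φ χ) (hχ : Injective χ) :
    groupTopEntropy φ = groupTopEntropy ψ + groupTopEntropy χ := by
  have hψ : Continuous ψ :=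
    hι.isInducing.continuous_iff.2 (hιφ.comp_eq ▸ hφ.comp hι.continuous)
  have hχc : Continuous χ :=
    hπ.isQuotientMap.continuous_iff.2 (hπφ.comp_eq ▸ hπ.continuous.comp hφ)
  have : NonarchimedeanGroup G := nonarchimedeanGroup_of_totallyDisconnectedSpace
  have : NonarchimedeanGroup N := nonarchimedeanGroup_of_isInducing hι.isInducing
  have : NonarchimedeanGroup Q := nonarchimedeanGroup_of_isOpenQuotientMap hπ
  have : LocallyCompactSpace N := hι.locallyCompactSpace
  have : LocallyCompactSpace Q := hπ.locallyCompactSpace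
  have : T2Space N := hι.isEmbedding.t2Space
  have : T2Space Q := t2Space_of_isQuotientMap_of_isClosed_ker hπ.isQuotientMap
    (hexact ▸ hι.isClosed_range)
  apply le_antisymm
  · rw [groupTopEntropy_eq_iSup hφ]
    refine iSup₂_le fun L hL ↦ ?_
    rw [expansionIndex_eq_mul hexact hιφ hπφ hχ hL.le_map, Nat.cast_mul, ENNReal.log_mul_add]
    exact add_le_add
      ((hL.comap hι hexact hιφ hπφ hχ).log_expansionIndex_le_groupTopEntropy hψ)
      ((hL.map hπ.continuous hπφ).log_expansionIndex_le_groupTopEntropy hχc)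
  · rw [groupTopEntropy_eq_iSup hψ, groupTopEntropy_eq_iSup hχc]
    refine EReal.add_le_of_forall_lt fun a ha b hb ↦ ?_
    simp only [lt_iSup_iff, exists_prop] at ha hb
    obtain ⟨L, hL, haL⟩ := ha
    obtain ⟨M, hM, hbM⟩ := hb
    have hπι (x : N) : π (ι x) = 1 := hexact.le ⟨x, rfl⟩
    exact (add_le_add haL.le hbM.le).trans
      (hL.log_add_log_le_groupTopEntropy hψ hχc hι.isInducing hπ hπι hιφ hπφ hM)

end ExactSequence

end TopologicalEntropy

theorem mainTheorem2 {G : Type*} [Group G] [TopologicalSpace G] [IsTopologicalGroup G]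
    [T2Space G] [LocallyCompactSpace G] [TotallyDisconnectedSpace G]
    (φ : G ≃ₜ* G) (H : Subgroup G) [H.Normal] (hclosed : IsClosed (H : Set G))
    (hstable : IsStable φ H) :
    groupTopEntropy φ =
      groupTopEntropy (restrictAut φ H hstable) + groupTopEntropy (quotientAut φ H hstable) := by
  exact mainTheorem2_general (φ := (φ : G →* G))
    (ψ := (restrictAut φ H hstable : H →* H)) (χ := (quotientAut φ H hstable : G ⧸ H →* G ⧸ H))
    (ι := H.subtype) (π := QuotientGroup.mk' H) φ.continuous
    hclosed.isClosedEmbedding_subtypeVal QuotientGroup.isOpenQuotientMap_mk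
    (H.range_subtype.trans (QuotientGroup.ker_mk' H).symm) (fun _ ↦ rfl) (fun _ ↦ rfl)
    (quotientAut φ H hstable).injective
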